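/- Let $d\in\mathbb N$, let $\mathcal H=\mathbb C^d$, and let $\mathcal S$ be the set of density operators on $\mathcal H$ (positive operators of trace one), with its usual topology and Borel $\sigma$-algebra $\mathfrak B(\mathcal S)$. A *full estimation scheme* is a sequence $(E_N)_{N\in\mathbb N}$ of normalized positive-operator-valued measures $E_N:\mathfrak B(\mathcal S)\to\mathcal B(\mathcal H^{\otimes N})$, i.e. $E_N$ is $\sigma$-additive with $E_N(\Delta)\ge 0$, $E_N(\emptyset)=0$ and $E_N(\mathcal S)=\mathbb 1$. For $\rho\in\mathcal S$ put $\mu_{N,\rho}(\Delta)=\operatorname{tr}\bigl(\rho^{\otimes N}E_N(\Delta)\bigr)$, a probability measure on $\mathcal S$. A function $I:\mathcal S\times\mathcal S\to[0,\infty]$ is called *admissible* if there is a full estimation scheme $(E_N)_{N\in\mathbb N}$ such that, for every $\rho\in\mathcal S$, 1. $I(\rho,\cdot)$ is a rate function: it is not identically $\infty$, it is lower semicontinuous, and its level sets $\{\sigma: I(\rho,\sigma)\le c\}$, $c\in\mathbb R$, are compact; 2. for all $\sigma\in\mathcal S$: $I(\rho,\sigma)=0$ if and only if $\sigma=\rho$;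 3. $(\mu_{N,\rho})_{N\in\mathbb N}$ satisfies the large deviation principle with rate function $I(\rho,\cdot)$, that is, $$\limsup_{N\to\infty}\frac1N\ln\mu_{N,\rho}(\Delta)\le-\inf_{\sigma\in\Delta}I(\rho,\sigma)\quad\text{for all closed }\Delta\subset\mathcal S,$$ $$\liminf_{N\to\infty}\frac1N\ln\mu_{N,\rho}(\Delta)\ge-\inf_{\sigma\in\Delta}I(\rho,\sigma)\quad\text{for all open }\Delta\subset\mathcal S,$$ with the conventions $\ln 0=-\infty$ and $\inf\emptyset=+\infty$. **Theorem.** Every admissible function $I$ is bounded from above by the quantum relative entropy: $$I(\rho,\sigma)\le S(\rho,\sigma)=\operatorname{tr}\bigl(\sigma\ln\sigma-\sigma\ln\rho\bigr)\qquad\text{for all }\rho,\sigma\in\mathcal S,$$ where $0\ln 0=0$ and $S(\rho,\sigma)=+\infty$ if $\ker\rho\not\subset\ker\sigma$. -/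

import Mathlib

open scoped ENNReal NNReal ComplexOrder

noncomputable section

namespace StateEstimation

/-- Density operators on `ℂ^d`: positive semidefinite complex `d × d` matrices of trace one. -/
def State (d : ℕ) : Type :=
  {ρ : Matrix (Fin d) (Fin d) ℂ // ρ.PosSemidef ∧ ρ.trace = 1}

/-- The underlying matrix of a density operator. -/
def State.mat {d : ℕ} (ρ : State d) : Matrix (Fin d) (Fin d) ℂ := ρ.1

/-- The usual (norm) topology on the state space. -/
instance State.instTopologicalSpace (d : ℕ) : TopologicalSpace (State d) := instTopologicalSpaceSubtype

/-- The Borel σ-algebra on the state space. -/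
instance State.instMeasurableSpace (d : ℕ) : MeasurableSpace (State d) := borel (State d)

instance State.instBorelSpace (d : ℕ) : BorelSpace (State d) := ⟨rfl⟩

/-- Operators on the `N`-fold tensor power of `ℂ^d`, written in the product basis
`e_{i 0} ⊗ ⋯ ⊗ e_{i (N - 1)}`, which is indexed by the maps `i : Fin N → Fin d`. -/
abbrev TensorOp (d N : ℕ) : Type :=
  Matrix (Fin N → Fin d) (Fin N → Fin d) ℂ

/-- The `N`-fold tensor power `A ⊗ ⋯ ⊗ A` of an operator `A` on `ℂ^d`. -/
def tensorPower {d : ℕ} (N : ℕ) (A : Matrix (Fin d) (Fin d) ℂ) : TensorOp d N :=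
  Matrix.of fun i j => ∏ k, A (i k) (j k)

theorem tensorPower_mul {d : ℕ} (N : ℕ) (A B : Matrix (Fin d) (Fin d) ℂ) :
    tensorPower N (A * B) = tensorPower N A * tensorPower N B := by
  ext i j
  simp only [tensorPower, Matrix.of_apply, Matrix.mul_apply, ← Finset.prod_mul_distrib]
  rw [Finset.prod_univ_sum]
  simp

theorem tensorPower_conjTranspose {d : ℕ} (N : ℕ) (A : Matrix (Fin d) (Fin d) ℂ) :
    tensorPower N A.conjTranspose = (tensorPower N A).conjTranspose := by
  ext i j
  simp [tensorPower, Matrix.conjTranspose_apply]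

open scoped MatrixOrder in
theorem exists_factor {ι : Type*} [Fintype ι] {A : Matrix ι ι ℂ} (hA : A.PosSemidef) :
    ∃ B : Matrix ι ι ℂ, A = B.conjTranspose * B := by
  classical
  exact CStarAlgebra.nonneg_iff_eq_star_mul_self.mp hA.nonneg

theorem tensorPower_posSemidef {d : ℕ} (N : ℕ) {A : Matrix (Fin d) (Fin d) ℂ}
    (hA : A.PosSemidef) : (tensorPower N A).PosSemidef := by
  obtain ⟨B, rfl⟩ := exists_factor hA
  rw [tensorPower_mul, tensorPower_conjTranspose]
  exact Matrix.posSemidef_conjTranspose_mul_self _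

theorem trace_tensorPower {d : ℕ} (N : ℕ) (A : Matrix (Fin d) (Fin d) ℂ) :
    (tensorPower N A).trace = A.trace ^ N := by
  simp only [Matrix.trace, Matrix.diag, tensorPower, Matrix.of_apply]
  rw [Finset.sum_pow', Fintype.piFinset_univ]

/-- A normalized positive operator valued measure on the σ-algebra of `X`, whose values are
complex matrices (operators on the Hilbert space `ℂ^ι`). `VectorMeasure` contains σ-additivity
and `E ∅ = 0`. -/
structure POVM (X : Type*) [MeasurableSpace X] (ι : Type*) [Fintype ι] [DecidableEq ι] where
  toVectorMeasure : MeasureTheory.VectorMeasure X (Matrix ι ι ℂ)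
  posSemidef : ∀ Δ : Set X, MeasurableSet Δ → (toVectorMeasure Δ).PosSemidef
  univ : toVectorMeasure Set.univ = 1

theorem trace_mul_re_nonneg {ι : Type*} [Fintype ι] {A B : Matrix ι ι ℂ}
    (hA : A.PosSemidef) (hB : B.PosSemidef) : 0 ≤ (A * B).trace.re := by
  classical
  obtain ⟨C, rfl⟩ := exists_factor hA
  rw [mul_assoc, Matrix.trace_mul_comm]
  exact (Complex.le_def.mp (hB.mul_mul_conjTranspose_same C).trace_nonneg).1

/-- The law `Δ ↦ tr (ω E(Δ))` of the outcome when the observable `E` is measured on a system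
in the (positive) state `ω`. -/
def POVM.law {X : Type*} [MeasurableSpace X] {ι : Type*} [Fintype ι] [DecidableEq ι]
    (E : POVM X ι) (ω : Matrix ι ι ℂ) (hω : ω.PosSemidef) : MeasureTheory.Measure X :=
  MeasureTheory.Measure.ofMeasurable
    (fun Δ _ => ENNReal.ofReal (ω * E.toVectorMeasure Δ).trace.re)
    (by simp)
    (by
      intro f hf hd
      have h := E.toVectorMeasure.m_iUnion hf hd
      let L : Matrix ι ι ℂ →+ ℝ :=
        { toFun := fun M => (ω * M).trace.re
          map_zero' := by simp
          map_add' := by intro M M'; simp [mul_add] }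
      have hL : Continuous L :=
        Complex.continuous_re.comp ((continuous_const.matrix_mul continuous_id).matrix_trace)
      have h' : HasSum (fun i => (ω * E.toVectorMeasure (f i)).trace.re)
          (ω * E.toVectorMeasure (⋃ i, f i)).trace.re := h.map L hL
      rw [← h'.tsum_eq]
      exact ENNReal.ofReal_tsum_of_nonneg
        (fun i => trace_mul_re_nonneg hω (E.posSemidef _ (hf i))) h'.summable)

/-- An estimation scheme with estimates in `X`: a sequence of observables `E N` on the `N`-fold
system with outcomes in `X`. -/
abbrev EstimationScheme (d : ℕ) (X : Type*) [MeasurableSpace X] : Type _ :=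
  (N : ℕ) → POVM X (Fin N → Fin d)

/-- The law `Δ ↦ tr (ρ^{⊗N} E_N(Δ))` of the estimate, for input systems in the state `ρ`. -/
def EstimationScheme.law {d : ℕ} {X : Type*} [MeasurableSpace X] (E : EstimationScheme d X)
    (N : ℕ) (ρ : State d) : MeasureTheory.Measure X :=
  (E N).law (tensorPower N ρ.mat) (tensorPower_posSemidef N ρ.2.1)

theorem EstimationScheme.law_apply {d : ℕ} {X : Type*} [MeasurableSpace X]
    (E : EstimationScheme d X) (N : ℕ) (ρ : State d) {Δ : Set X} (hΔ : MeasurableSet Δ) :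
    E.law N ρ Δ =
      ENNReal.ofReal (tensorPower N ρ.mat * (E N).toVectorMeasure Δ).trace.re := by
  unfold EstimationScheme.law POVM.law
  exact MeasureTheory.Measure.ofMeasurable_apply Δ hΔ

instance EstimationScheme.isProbabilityMeasure_law {d : ℕ} {X : Type*} [MeasurableSpace X] (E : EstimationScheme d X) (N : ℕ)
    (ρ : State d) : MeasureTheory.IsProbabilityMeasure (E.law N ρ) where
  measure_univ := by
    have h : ρ.mat.trace = 1 := ρ.2.2
    rw [E.law_apply N ρ MeasurableSet.univ, (E N).univ, mul_one, trace_tensorPower, h]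
    simp

/-- Rate functions on a topological space: not identically infinite, lower semicontinuous, and
with compact level sets. -/
structure IsRateFunction {X : Type*} [TopologicalSpace X] (I : X → ℝ≥0∞) : Prop where
  exists_ne_top : ∃ x, I x ≠ ⊤
  lowerSemicontinuous : LowerSemicontinuous I
  isCompact_level : ∀ c : ℝ≥0, IsCompact {x | I x ≤ c}

/-- The large deviation bounds, with rate function `I`, for a sequence of measures.
Here `ENNReal.log` is the logarithm with values in `[-∞, ∞]` and `log 0 = -∞`. -/
structure LargeDeviationPrinciple {X : Type*} [TopologicalSpace X] [MeasurableSpace X]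
    (μ : ℕ → MeasureTheory.Measure X) (I : X → ℝ≥0∞) : Prop where
  upper : ∀ Δ : Set X, IsClosed Δ →
    Filter.limsup (fun N : ℕ => (((1 / (N : ℝ)) : ℝ) : EReal) * ENNReal.log (μ N Δ)) Filter.atTop
      ≤ -((⨅ x ∈ Δ, I x : ℝ≥0∞) : EReal)
  lower : ∀ Δ : Set X, IsOpen Δ →
    -((⨅ x ∈ Δ, I x : ℝ≥0∞) : EReal) ≤
      Filter.liminf (fun N : ℕ => (((1 / (N : ℝ)) : ℝ) : EReal) * ENNReal.log (μ N Δ)) Filter.atTop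

/-- An estimation scheme for the quantity `p` satisfies the large deviation principle with rate
function `I`. -/
structure EstimationScheme.SatisfiesLDP {d : ℕ} {X : Type*} [TopologicalSpace X]
    [MeasurableSpace X] (E : EstimationScheme d X) (p : State d → X)
    (I : State d → X → ℝ≥0∞) : Prop where
  isRateFunction : ∀ ρ, IsRateFunction (I ρ)
  eq_zero_iff : ∀ ρ x, I ρ x = 0 ↔ p ρ = x
  ldp : ∀ ρ, LargeDeviationPrinciple (fun N => E.law N ρ) (I ρ)

/-- `I` is `p`-admissible if it is the rate function of some estimation scheme for `p`. -/
def IsAdmissible {d : ℕ} {X : Type*} [TopologicalSpace X] [MeasurableSpace X]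
    (p : State d → X) (I : State d → X → ℝ≥0∞) : Prop :=
  ∃ E : EstimationScheme d X, E.SatisfiesLDP p I

open Classical in
/-- The quantum relative entropy `S(ρ, σ) = tr (σ ln σ - σ ln ρ)`, which is `+∞` unless the
kernel of `ρ` is contained in the kernel of `σ`. The logarithm of a Hermitian matrix is given by
the functional calculus; it is `0` on the kernel, so `σ ln σ` follows the convention
`0 ln 0 = 0`, and the kernel of `ρ` does not contribute to `σ ln ρ` in the finite case. -/
def relativeEntropy {d : ℕ} (ρ σ : State d) : EReal :=
  if ∀ v : Fin d → ℂ, ρ.mat.mulVec v = 0 → σ.mat.mulVec v = 0 then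
    (((σ.mat * cfc Real.log σ.mat - σ.mat * cfc Real.log ρ.mat).trace.re : ℝ) : EReal)
  else ⊤

end StateEstimation

end

/-! An estimation scheme is also a family of hypothesis tests. For a closed neighborhood `Δ` of `σ`,
the effect `A = E_N(Δ)` accepts `σ^{⊗N}` up to an exponentially small error, because `I(σ,·)` is
bounded away from `0` outside the interior of `Δ`. By the converse part of Stein's lemma such a test
must accept `ρ^{⊗N}` with probability at least `exp(-NL)` for large `N`, whenever `L > S(ρ,σ)`. The
upper large deviation bound for `ρ` then gives `inf_Δ I(ρ,·) ≤ L`, and shrinking `Δ` to `σ` finishes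
by lower semicontinuity.

The converse is reduced to a classical one. With eigenvalues `r`, `s` and eigenbases `u`, `v` of
`ρ`, `σ`, put `q(i,j) = r_j |⟨v_i,u_j⟩|²` and `p(i,j) = s_i |⟨v_i,u_j⟩|²`. Their Kullback–Leibler
divergence is `S(ρ,σ)`, tensor powers become product distributions, and classical errors bound
quantum ones from below up to a factor `1/2`. -/

namespace StateEstimation

/-! ### Quantum tests versus classical tests -/

section Effects

variable {ι : Type*} [Fintype ι] [DecidableEq ι]

theorem trace_mul_sq_effect_le {ω A : Matrix ι ι ℂ} (hω : ω.PosSemidef) (hA : A.PosSemidef)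
    (hA' : (1 - A).PosSemidef) : (ω * (A * A)).trace.re ≤ (ω * A).trace.re := by
  have h1 := hA'.mul_mul_conjTranspose_same A
  have h2 := hA.mul_mul_conjTranspose_same (1 - A)
  rw [hA.isHermitian.eq] at h1
  rw [hA'.isHermitian.eq] at h2
  have h3 := trace_mul_re_nonneg hω (h1.add h2)
  have h4 : A * (1 - A) * A + (1 - A) * A * (1 - A) = A - A * A := by noncomm_ring
  rw [h4, mul_sub, Matrix.trace_sub, Complex.sub_re] at h3
  linarith

/-- The second basis `V` is inserted so that the traces for two states become sums over the same
index pairs. -/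
theorem trace_diagonal_mul_sq_re {U V A : Matrix ι ι ℂ} (hV : V * star V = 1)
    (hA : A.IsHermitian) (r : ι → ℝ) :
    (U * Matrix.diagonal (fun j => (r j : ℂ)) * star U * (A * A)).trace.re
      = ∑ i, ∑ j, r j * ‖(star V * A * U) i j‖ ^ 2 := by
  set B := star V * A * U with hB
  have h1 : star B * B = star U * (A * A) * U := by
    have hA' : star A = A := hA
    calc star B * B = star U * (A * (V * star V) * A) * U := by
          rw [hB, star_mul, star_mul, star_star, hA']; simp only [mul_assoc]
      _ = _ := by rw [hV, mul_one]
  have h2 : (U * Matrix.diagonal (fun j => (r j : ℂ)) * star U * (A * A)).trace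
      = (Matrix.diagonal (fun j => (r j : ℂ)) * (star B * B)).trace := by
    rw [h1, mul_assoc, mul_assoc, Matrix.trace_mul_comm]
    simp only [mul_assoc]
  rw [h2, Matrix.trace, Complex.re_sum, Finset.sum_comm]
  refine Finset.sum_congr rfl fun j _ => ?_
  rw [Matrix.diag_apply, Matrix.diagonal_mul, Complex.re_ofReal_mul, ← Finset.mul_sum,
    Matrix.mul_apply, Complex.re_sum]
  congr 1
  refine Finset.sum_congr rfl fun i _ => ?_
  rw [Matrix.star_apply, Complex.star_def, ← Complex.normSq_eq_conj_mul_self,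
    Complex.ofReal_re, Complex.normSq_eq_norm_sq]

theorem trace_conj_diagonal_mul_re (U V : Matrix ι ι ℂ) (u s : ι → ℝ) :
    (V * Matrix.diagonal (fun i => (s i : ℂ)) * star V
        * (U * Matrix.diagonal (fun j => (u j : ℂ)) * star U)).trace.re
      = ∑ i, ∑ j, s i * ‖(star V * U) i j‖ ^ 2 * u j := by
  set W := star V * U with hW
  have h1 : (V * Matrix.diagonal (fun i => (s i : ℂ)) * star V
        * (U * Matrix.diagonal (fun j => (u j : ℂ)) * star U)).trace
      = (Matrix.diagonal (fun i => (s i : ℂ))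
          * (W * Matrix.diagonal (fun j => (u j : ℂ)) * star W)).trace := by
    rw [hW, star_mul, star_star, mul_assoc, mul_assoc, Matrix.trace_mul_comm]
    simp only [mul_assoc]
  rw [h1, Matrix.trace, Complex.re_sum]
  refine Finset.sum_congr rfl fun i _ => ?_
  rw [Matrix.diag_apply, Matrix.diagonal_mul, Complex.re_ofReal_mul, Matrix.mul_apply,
    Complex.re_sum, Finset.mul_sum]
  refine Finset.sum_congr rfl fun j _ => ?_
  rw [Matrix.mul_diagonal, Matrix.star_apply, Complex.star_def, mul_right_comm, Complex.mul_conj,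
    ← Complex.ofReal_mul, Complex.ofReal_re, Complex.normSq_eq_norm_sq, mul_assoc]

theorem sum_norm_sq_star_mul {U V : Matrix ι ι ℂ} (hU : U * star U = 1) (hV : V * star V = 1)
    (i : ι) : ∑ j, ‖(star V * U) i j‖ ^ 2 = 1 := by
  set W := star V * U with hW
  have h1 : W * star W = 1 := by
    have hV' : star V * V = 1 := mul_eq_one_comm.mp hV
    rw [hW, star_mul, star_star, mul_assoc, ← mul_assoc U, hU, one_mul, hV']
  have h2 := congrArg Complex.re (congrFun (congrFun h1 i) i)
  rw [Matrix.mul_apply, Complex.re_sum, Matrix.one_apply_eq, Complex.one_re] at h2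
  rw [← h2]
  refine Finset.sum_congr rfl fun j _ => ?_
  rw [Matrix.star_apply, Complex.star_def, Complex.mul_conj, Complex.ofReal_re,
    Complex.normSq_eq_norm_sq]

theorem posSemidef_conj_diagonal (U : Matrix ι ι ℂ) {r : ι → ℝ} (hr : ∀ j, 0 ≤ r j) :
    (U * Matrix.diagonal (fun j => (r j : ℂ)) * star U).PosSemidef :=
  (Matrix.PosSemidef.diagonal (fun j => by simpa using hr j)).mul_mul_conjTranspose_same U

/-- Lower bound on the errors of a quantum hypothesis test by those of a classical test between
the Nussbaum–Szkoła distributions. -/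
theorem half_sum_min_le_trace {U V A : Matrix ι ι ℂ} (hU : U * star U = 1) (hV : V * star V = 1)
    {r s : ι → ℝ} (hr : ∀ j, 0 ≤ r j) (hs : ∀ i, 0 ≤ s i) (hA : A.PosSemidef)
    (hA' : (1 - A).PosSemidef) {l : ℝ} (hl : 0 ≤ l) :
    1 / 2 * ∑ i, ∑ j, min (r j) (l * s i) * ‖(star V * U) i j‖ ^ 2
      ≤ (U * Matrix.diagonal (fun j => (r j : ℂ)) * star U * A).trace.re
        + l * (V * Matrix.diagonal (fun i => (s i : ℂ)) * star V * (1 - A)).trace.re := by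
  have h1 := trace_mul_sq_effect_le (posSemidef_conj_diagonal U hr) hA hA'
  have h2 := trace_mul_sq_effect_le (posSemidef_conj_diagonal V hs) hA' (by simpa using hA)
  rw [trace_diagonal_mul_sq_re hV hA.isHermitian] at h1
  rw [trace_diagonal_mul_sq_re hU hA'.isHermitian, Finset.sum_comm] at h2
  refine le_trans ?_ (add_le_add h1 (mul_le_mul_of_nonneg_left h2 hl))
  simp only [Finset.mul_sum, ← Finset.sum_add_distrib]
  refine Finset.sum_le_sum fun i _ => Finset.sum_le_sum fun j _ => ?_
  have h3 : ‖(star U * (1 - A) * V) j i‖ = ‖(star V * (1 - A) * U) i j‖ := by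
    have : star U * (1 - A) * V = star (star V * (1 - A) * U) := by
      have hA'' : star (1 - A) = 1 - A := hA'.isHermitian
      rw [star_mul, star_mul, star_star, hA'', mul_assoc]
    rw [this, Matrix.star_apply, norm_star]
  have h4 : (star V * U) i j = (star V * A * U) i j + (star V * (1 - A) * U) i j := by
    rw [← Matrix.add_apply, mul_sub, mul_one, sub_mul, add_sub_cancel]
  rw [h3, h4]
  set b := (star V * A * U) i j
  set c := (star V * (1 - A) * U) i j
  -- The overlap `⟨v_i,u_j⟩` splits into an accepted part `b` and a rejected part `c`; this
  -- inequality is the source of the factor `1/2`.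
  have h5 : ‖b + c‖ ^ 2 ≤ 2 * (‖b‖ ^ 2 + ‖c‖ ^ 2) := by
    have := norm_add_le b c
    nlinarith [sq_nonneg (‖b‖ - ‖c‖), norm_nonneg (b + c), norm_nonneg b, norm_nonneg c]
  have hm : 0 ≤ min (r j) (l * s i) := le_min (hr j) (mul_nonneg hl (hs i))
  have h6 := mul_le_mul_of_nonneg_right (min_le_left (r j) (l * s i)) (sq_nonneg ‖b‖)
  have h7 := mul_le_mul_of_nonneg_right (min_le_right (r j) (l * s i)) (sq_nonneg ‖c‖)
  have h8 := mul_le_mul_of_nonneg_left h5 hm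
  nlinarith

end Effects

/-! ### Classical Chernoff bound -/

section Chernoff

variable {X : Type*} [Fintype X]

/-- As a function of `t` the sum is `1` at `0`, with negative derivative `∑ p f - L` there. -/
theorem exists_sum_mul_exp_lt_one {p f : X → ℝ} (hp1 : ∑ x, p x = 1) {L : ℝ}
    (hL : ∑ x, p x * f x < L) : ∃ t : ℝ, 0 < t ∧ ∑ x, p x * Real.exp (t * (f x - L)) < 1 := by
  have hd : HasDerivAt (fun t : ℝ => ∑ x, p x * Real.exp (t * (f x - L)))
      (∑ x, p x * (f x - L)) 0 := by
    refine HasDerivAt.fun_sum fun x _ => ?_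
    have := (((hasDerivAt_id (0 : ℝ)).mul_const (f x - L)).exp).const_mul (p x)
    simpa using this
  have hneg : ∑ x, p x * (f x - L) < 0 := by
    simp only [mul_sub, Finset.sum_sub_distrib, ← Finset.sum_mul, hp1]
    linarith
  have ht := (hasDerivAt_iff_tendsto_slope.mp hd).mono_left
    (nhdsWithin_mono 0 (fun y (hy : y ∈ Set.Ioi (0 : ℝ)) => ne_of_gt hy))
  obtain ⟨t, h1, h2⟩ := ((ht.eventually_lt_const hneg).and self_mem_nhdsWithin).exists
  have h2 : 0 < t := h2
  refine ⟨t, h2, ?_⟩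
  rw [slope_def_field, sub_zero, div_lt_iff₀ h2] at h1
  simp [hp1] at h1
  linarith

/-- Chernoff-type bound: for `L` above the Kullback–Leibler divergence of `p` from `q`, the
overlap of `q^N` and `exp (- N L) p^N` is almost `exp (- N L)`. -/
theorem exists_pow_le_sum_min_prod {p q : X → ℝ} (hp : ∀ x, 0 ≤ p x) (hq : ∀ x, 0 ≤ q x)
    (hp1 : ∑ x, p x = 1) (hpq : ∀ x, q x = 0 → p x = 0) {L : ℝ}
    (hL : ∑ x, p x * Real.log (p x / q x) < L) :
    ∃ a : ℝ, 0 ≤ a ∧ a < 1 ∧ ∀ N : ℕ, Real.exp (-(N * L)) * (1 - a ^ N)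
      ≤ ∑ x : Fin N → X, min (∏ k, q (x k)) (Real.exp (-(N * L)) * ∏ k, p (x k)) := by
  obtain ⟨t, ht, hlt⟩ := exists_sum_mul_exp_lt_one hp1 hL
  -- Here `a` is the exponential moment, so `a ^ N` bounds the `p^N`-probability that the
  -- log-likelihood ratio `F` exceeds `N L`.
  refine ⟨_, Finset.sum_nonneg fun x _ => mul_nonneg (hp x) (Real.exp_pos _).le, hlt,
    fun N => ?_⟩
  have h1 : (1 : ℝ) = ∑ x : Fin N → X, ∏ k, p (x k) := by
    rw [← one_pow N, ← hp1, Finset.sum_pow', Fintype.piFinset_univ]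
  rw [Finset.sum_pow', Fintype.piFinset_univ, h1, ← Finset.sum_sub_distrib, Finset.mul_sum]
  refine Finset.sum_le_sum fun x _ => le_min ?_ ?_
  · by_cases h0 : ∃ k, p (x k) = 0
    · obtain ⟨k, hk⟩ := h0
      rw [Finset.prod_eq_zero (Finset.mem_univ k) hk,
        Finset.prod_eq_zero (Finset.mem_univ k) (by rw [hk, zero_mul]), sub_zero, mul_zero]
      exact Finset.prod_nonneg fun k _ => hq _
    · push Not at h0
      have hq0 : ∀ k, 0 < q (x k) := fun k =>
        lt_of_le_of_ne (hq _) fun h => h0 k (hpq _ h.symm)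
      have hp0 : ∀ k, 0 < p (x k) := fun k => lt_of_le_of_ne (hp _) (h0 k).symm
      set F := ∑ k, Real.log (p (x k) / q (x k)) with hF
      have h2 : ∏ k, p (x k) = (∏ k, q (x k)) * Real.exp F := by
        rw [hF, Real.exp_sum, ← Finset.prod_mul_distrib]
        refine Finset.prod_congr rfl fun k _ => ?_
        rw [Real.exp_log (div_pos (hp0 k) (hq0 k)), mul_div_cancel₀ _ (hq0 k).ne']
      have h3 : ∏ k, p (x k) * Real.exp (t * (Real.log (p (x k) / q (x k)) - L))
          = (∏ k, p (x k)) * Real.exp (t * (F - N * L)) := by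
        rw [Finset.prod_mul_distrib, ← Real.exp_sum, ← Finset.mul_sum, Finset.sum_sub_distrib]
        simp [hF]
      rw [h3]
      have hP : 0 ≤ ∏ k, p (x k) := Finset.prod_nonneg fun k _ => hp _
      have hQ : 0 ≤ ∏ k, q (x k) := Finset.prod_nonneg fun k _ => hq _
      -- If `F ≤ N L`, then `exp(-N L) p^N ≤ q^N` pointwise; otherwise the moment factor is at least
      -- `1` and the left side is nonpositive.
      rcases le_or_gt F (N * L) with hc | hc
      · calc _ ≤ Real.exp (-(N * L)) * ∏ k, p (x k) := by
              gcongr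
              exact sub_le_self _ (mul_nonneg hP (Real.exp_pos _).le)
          _ = (∏ k, q (x k)) * Real.exp (F - N * L) := by
              rw [h2, sub_eq_add_neg, Real.exp_add]; ring
          _ ≤ (∏ k, q (x k)) * 1 := by
              gcongr
              exact Real.exp_le_one_iff.mpr (by linarith)
          _ = _ := mul_one _
      · refine le_trans (mul_nonpos_of_nonneg_of_nonpos (Real.exp_pos _).le ?_) hQ
        have : 1 ≤ Real.exp (t * (F - N * L)) :=
          Real.one_le_exp (mul_nonneg ht.le (by linarith))
        nlinarith
  · gcongr
    exact sub_le_self _ (Finset.prod_nonneg fun k _ => mul_nonneg (hp _) (Real.exp_pos _).le)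

end Chernoff

/-! ### Stein converse in eigenbases -/

section TensorPower

variable {d : ℕ}

theorem tensorPower_diagonal (N : ℕ) (r : Fin d → ℂ) :
    tensorPower N (Matrix.diagonal r) = Matrix.diagonal fun i => ∏ k, r (i k) := by
  ext i j
  by_cases h : i = j
  · subst h
    simp [tensorPower]
  · obtain ⟨k, hk⟩ := Function.ne_iff.mp h
    rw [Matrix.diagonal_apply_ne _ h]
    exact Finset.prod_eq_zero (Finset.mem_univ k) (Matrix.diagonal_apply_ne _ hk)

theorem tensorPower_one (N : ℕ) : tensorPower N (1 : Matrix (Fin d) (Fin d) ℂ) = 1 := by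
  rw [← Matrix.diagonal_one, tensorPower_diagonal]
  simp

/-- Converse part of the quantum Stein lemma for states given in diagonalized form. -/
theorem exists_pow_le_trace_tensorPower {U V : Matrix (Fin d) (Fin d) ℂ} (hU : U * star U = 1)
    (hV : V * star V = 1) {r s : Fin d → ℝ} (hr : ∀ j, 0 ≤ r j) (hs : ∀ i, 0 ≤ s i)
    (hs1 : ∑ i, s i = 1)
    (hrs : ∀ i j, r j = 0 → s i = 0 ∨ (star V * U) i j = 0) {L : ℝ}
    (hL : ∑ i, ∑ j, s i * ‖(star V * U) i j‖ ^ 2 * (Real.log (s i) - Real.log (r j)) < L) :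
    ∃ a : ℝ, 0 ≤ a ∧ a < 1 ∧ ∀ (N : ℕ) (A : TensorOp d N), A.PosSemidef → (1 - A).PosSemidef →
      Real.exp (-(N * L)) * (1 / 2 * (1 - a ^ N)
        - (tensorPower N (V * Matrix.diagonal (fun i => (s i : ℂ)) * star V)
            * (1 - A)).trace.re)
      ≤ (tensorPower N (U * Matrix.diagonal (fun j => (r j : ℂ)) * star U) * A).trace.re := by
  set W := star V * U with hW
  have hrow : ∀ i, ∑ j, ‖W i j‖ ^ 2 = 1 := sum_norm_sq_star_mul hU hV
  obtain ⟨a, ha0, ha1, ha⟩ := exists_pow_le_sum_min_prod (X := Fin d × Fin d)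
    (p := fun x => s x.1 * ‖W x.1 x.2‖ ^ 2) (q := fun x => r x.2 * ‖W x.1 x.2‖ ^ 2) (L := L)
    (fun x => mul_nonneg (hs _) (sq_nonneg _)) (fun x => mul_nonneg (hr _) (sq_nonneg _))
    (by simp [Fintype.sum_prod_type, ← Finset.mul_sum, hrow, hs1])
    (by
      intro x hx
      rcases mul_eq_zero.mp hx with h | h
      · rcases hrs x.1 x.2 h with h' | h' <;> simp [h']
      · simp only [h, mul_zero])
    (by
      refine lt_of_eq_of_lt ?_ hL
      rw [Fintype.sum_prod_type]
      refine Finset.sum_congr rfl fun i _ => Finset.sum_congr rfl fun j _ => ?_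
      by_cases hw : W i j = 0
      · simp [hw]
      by_cases hsi : s i = 0
      · simp [hsi]
      have hrj : r j ≠ 0 := fun h => (hrs i j h).elim hsi hw
      have hw2 : ‖W i j‖ ^ 2 ≠ 0 := pow_ne_zero _ (norm_ne_zero_iff.mpr hw)
      rw [mul_div_mul_right _ _ hw2, Real.log_div hsi hrj])
  refine ⟨a, ha0, ha1, fun N A hA hA' => ?_⟩
  have key := half_sum_min_le_trace (U := tensorPower N U) (V := tensorPower N V)
    (r := fun j => ∏ k, r (j k)) (s := fun i => ∏ k, s (i k))
    (by rw [Matrix.star_eq_conjTranspose, ← tensorPower_conjTranspose, ← tensorPower_mul,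
          ← Matrix.star_eq_conjTranspose, hU, tensorPower_one])
    (by rw [Matrix.star_eq_conjTranspose, ← tensorPower_conjTranspose, ← tensorPower_mul,
          ← Matrix.star_eq_conjTranspose, hV, tensorPower_one])
    (fun j => Finset.prod_nonneg fun k _ => hr _) (fun i => Finset.prod_nonneg fun k _ => hs _)
    hA hA' (Real.exp_pos (-(N * L))).le
  have hconj : ∀ (T : Matrix (Fin d) (Fin d) ℂ) (u : Fin d → ℝ),
      tensorPower N T * Matrix.diagonal (fun j => ((∏ k, u (j k) : ℝ) : ℂ))
        * star (tensorPower N T)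
      = tensorPower N (T * Matrix.diagonal (fun j => (u j : ℂ)) * star T) := by
    intro T u
    rw [tensorPower_mul, tensorPower_mul, tensorPower_diagonal, Matrix.star_eq_conjTranspose,
      Matrix.star_eq_conjTranspose, tensorPower_conjTranspose]
    push_cast
    rfl
  have hW' : star (tensorPower N V) * tensorPower N U = tensorPower N W := by
    rw [Matrix.star_eq_conjTranspose, ← tensorPower_conjTranspose, ← tensorPower_mul, hW,
      Matrix.star_eq_conjTranspose]
  rw [hconj, hconj, hW'] at key
  -- Sequences of pairs are pairs of sequences, and the common overlap factor leaves the minimum.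
  have hsum : ∑ x : Fin N → Fin d × Fin d, min (∏ k, r (x k).2 * ‖W (x k).1 (x k).2‖ ^ 2)
        (Real.exp (-(N * L)) * ∏ k, s (x k).1 * ‖W (x k).1 (x k).2‖ ^ 2)
      = ∑ i : Fin N → Fin d, ∑ j : Fin N → Fin d,
        min (∏ k, r (j k)) (Real.exp (-(N * L)) * ∏ k, s (i k))
          * ‖tensorPower N W i j‖ ^ 2 := by
    rw [← Fintype.sum_prod_type', ← (Equiv.arrowProdEquivProdArrow (Fin N) (fun _ => Fin d)
      (fun _ => Fin d)).sum_comp]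
    refine Finset.sum_congr rfl fun x _ => ?_
    have hn : ‖tensorPower N W (fun k => (x k).1) (fun k => (x k).2)‖ ^ 2
        = ∏ k, ‖W (x k).1 (x k).2‖ ^ 2 := by
      simp [tensorPower, Finset.prod_pow]
    simp only [Equiv.arrowProdEquivProdArrow, Equiv.coe_fn_mk]
    rw [hn, min_mul_of_nonneg _ _ (Finset.prod_nonneg fun k _ => sq_nonneg _),
      Finset.prod_mul_distrib, Finset.prod_mul_distrib, mul_assoc]
  have := ha N
  rw [hsum] at this
  linarith

end TensorPower

/-! ### Stein converse for states -/

section RelativeEntropy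

variable {d : ℕ}

theorem State.exists_diagonalization (ρ : State d) :
    ∃ (U : Matrix (Fin d) (Fin d) ℂ) (r : Fin d → ℝ), U * star U = 1 ∧ (∀ j, 0 ≤ r j) ∧
      ρ.mat = U * Matrix.diagonal (fun j => (r j : ℂ)) * star U ∧
      ∀ f : ℝ → ℝ, cfc f ρ.mat = U * Matrix.diagonal (fun j => (f (r j) : ℂ)) * star U := by
  have h : ρ.mat.IsHermitian := ρ.2.1.isHermitian
  refine ⟨h.eigenvectorUnitary, h.eigenvalues, Unitary.coe_mul_star_self _,
    fun j => Matrix.PosSemidef.eigenvalues_nonneg ρ.2.1 j, ?_, fun f => ?_⟩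
  · exact h.spectral_theorem
  · exact h.cfc_eq f

/-- Converse part of the quantum Stein lemma. -/
theorem exists_pow_le_trace_of_relativeEntropy_lt {ρ σ : State d}
    (hker : ∀ v : Fin d → ℂ, ρ.mat.mulVec v = 0 → σ.mat.mulVec v = 0) {L : ℝ}
    (hL : (σ.mat * cfc Real.log σ.mat - σ.mat * cfc Real.log ρ.mat).trace.re < L) :
    ∃ a : ℝ, 0 ≤ a ∧ a < 1 ∧ ∀ (N : ℕ) (A : TensorOp d N), A.PosSemidef → (1 - A).PosSemidef →
      Real.exp (-(N * L)) * (1 / 2 * (1 - a ^ N) - (tensorPower N σ.mat * (1 - A)).trace.re)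
      ≤ (tensorPower N ρ.mat * A).trace.re := by
  obtain ⟨U, r, hU, hr, hρ, hρf⟩ := ρ.exists_diagonalization
  obtain ⟨V, s, hV, hs, hσ, hσf⟩ := σ.exists_diagonalization
  have hU' : star U * U = 1 := mul_eq_one_comm.mp hU
  have hV' : star V * V = 1 := mul_eq_one_comm.mp hV
  have hs1 : ∑ i, s i = 1 := by
    have h : σ.mat.trace = 1 := σ.2.2
    rw [hσ, Matrix.trace_mul_comm, ← mul_assoc, hV', one_mul, Matrix.trace_diagonal] at h
    exact_mod_cast h
  have hrs : ∀ i j, r j = 0 → s i = 0 ∨ (star V * U) i j = 0 := by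
    intro i j hj
    -- The eigenvector `u_j` lies in `ker ρ`, hence in `ker σ`; its `v_i`-coefficient after applying
    -- `σ` is `s_i ⟨v_i,u_j⟩`.
    have h1 : ρ.mat.mulVec (U.mulVec (Pi.single j 1)) = 0 := by
      rw [hρ, Matrix.mulVec_mulVec, mul_assoc, hU', mul_one, ← Matrix.mulVec_mulVec]
      simp [hj]
    have h2 := congrArg (star V).mulVec (hker _ h1)
    rw [hσ, Matrix.mulVec_mulVec, Matrix.mulVec_mulVec, Matrix.mulVec_zero, ← mul_assoc,
      ← mul_assoc, hV', one_mul, mul_assoc] at h2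
    have h3 := congrFun h2 i
    rw [Matrix.mulVec_single_one, Matrix.col_apply, Matrix.diagonal_mul] at h3
    simpa using h3
  rw [hρ, hσ]
  refine exists_pow_le_trace_tensorPower hU hV hr hs hs1 hrs (lt_of_eq_of_lt ?_ hL)
  rw [hρf, hσf, hσ, Matrix.trace_sub, Complex.sub_re, trace_conj_diagonal_mul_re,
    trace_conj_diagonal_mul_re, hV', ← Finset.sum_sub_distrib]
  refine Finset.sum_congr rfl fun i _ => ?_
  -- The overlaps in each row sum to `1`, so `tr σ ln σ` can be spread over the double sum of `tr σ
  -- ln ρ`.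
  have h1 : ∑ j, s i * ‖(1 : Matrix (Fin d) (Fin d) ℂ) i j‖ ^ 2 * Real.log (s j)
      = ∑ j, s i * ‖(star V * U) i j‖ ^ 2 * Real.log (s i) := by
    rw [← Finset.sum_mul, ← Finset.mul_sum, sum_norm_sq_star_mul hU hV,
      Finset.sum_eq_single i]
    · simp
    · intro j _ hj
      simp [Matrix.one_apply_ne hj.symm]
    · simp
  rw [h1, ← Finset.sum_sub_distrib]
  exact Finset.sum_congr rfl fun j _ => mul_sub _ _ _

end RelativeEntropy

/-! ### Rate functions and exponential bounds -/

section LargeDeviations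

variable {X : Type*} [TopologicalSpace X]

/-- On the compact set `{I ≤ 1} ∩ Δ`, if nonempty, the minimum is attained and nonzero; on the rest
of `Δ`, `I > 1`. -/
theorem IsRateFunction.iInf_pos {I : X → ℝ≥0∞} (hI : IsRateFunction I) {Δ : Set X}
    (hΔ : IsClosed Δ) (h0 : ∀ x ∈ Δ, I x ≠ 0) : 0 < ⨅ x ∈ Δ, I x := by
  by_cases hne : ({x | I x ≤ (1 : ℝ≥0)} ∩ Δ).Nonempty
  · obtain ⟨x, hx, hmin⟩ := LowerSemicontinuousOn.exists_isMinOn hne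
      ((hI.isCompact_level 1).inter_right hΔ) (hI.lowerSemicontinuous.lowerSemicontinuousOn _)
    refine lt_of_lt_of_le (lt_min (pos_iff_ne_zero.mpr (h0 x hx.2)) one_pos)
      (le_iInf₂ fun y hy => ?_)
    by_cases h1 : I y ≤ 1
    · exact (min_le_left _ _).trans (hmin ⟨by simpa using h1, hy⟩)
    · exact (min_le_right _ _).trans (not_le.mp h1).le
  · refine lt_of_lt_of_le one_pos (le_iInf₂ fun y hy => ?_)
    by_contra h1
    exact hne ⟨y, by simpa using (not_le.mp h1).le, hy⟩

/-- A lower semicontinuous function on a regular space is bounded at a point by any bound for its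
infima over the closed neighborhoods of the point. -/
theorem le_of_iInf_closed_nhds_le [RegularSpace X] {I : X → ℝ≥0∞} {x : X} (hI : LowerSemicontinuous I) {c : ℝ}
    (h : ∀ Δ : Set X, IsClosed Δ → Δ ∈ nhds x → ((⨅ y ∈ Δ, I y : ℝ≥0∞) : EReal) ≤ c) :
    (I x : EReal) ≤ c := by
  have h0 : 0 ≤ c := by
    have := (EReal.coe_ennreal_nonneg _).trans (h Set.univ isClosed_univ Filter.univ_mem)
    exact_mod_cast this
  have hcc : (c : EReal) = ((ENNReal.ofReal c : ℝ≥0∞) : EReal) := by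
    rw [EReal.coe_ennreal_ofReal, max_eq_left h0]
  rw [hcc] at h ⊢
  simp only [EReal.coe_ennreal_le_coe_ennreal_iff] at h ⊢
  refine le_of_forall_lt fun b hb => ?_
  obtain ⟨b', hb', hb''⟩ : ∃ b' : ℝ≥0∞, b < b' ∧ b' < I x := exists_between hb
  obtain ⟨Δ, ⟨hn, hcl⟩, hsub⟩ := (closed_nhds_basis x).mem_iff.mp (hI x b' hb'')
  exact hb'.trans_le ((le_iInf₂ fun y hy => (hsub hy).le).trans (h Δ hcl hn))

theorem le_inv_mul_log_of_exp_le {N : ℕ} (hN : N ≠ 0) {c : ℝ} {m : ℝ≥0∞}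
    (h : ENNReal.ofReal (Real.exp (N * c)) ≤ m) :
    (c : EReal) ≤ ((1 / (N : ℝ) : ℝ) : EReal) * ENNReal.log m := by
  have hN' : (0 : ℝ) < N := by positivity
  have h1 := ENNReal.log_le_log h
  rw [ENNReal.log_ofReal_of_pos (Real.exp_pos _), Real.log_exp] at h1
  have h2 : (c : EReal) = ((1 / (N : ℝ) : ℝ) : EReal) * ((N * c : ℝ) : EReal) := by
    rw [← EReal.coe_mul]
    congr 1
    field_simp
  rw [h2]
  exact mul_le_mul_of_nonneg_left h1 (by exact_mod_cast (by positivity : (0 : ℝ) ≤ 1 / N))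

variable [MeasurableSpace X] {μ : ℕ → MeasureTheory.Measure X} {I : X → ℝ≥0∞}

theorem LargeDeviationPrinciple.exists_le_exp (h : LargeDeviationPrinciple μ I) {Δ : Set X}
    (hΔ : IsClosed Δ) (hpos : 0 < ⨅ x ∈ Δ, I x) :
    ∃ c : ℝ, 0 < c ∧ ∀ᶠ N : ℕ in Filter.atTop,
      μ N Δ ≤ ENNReal.ofReal (Real.exp (N * -c)) := by
  obtain ⟨c, hc0, hc⟩ := ENNReal.lt_iff_exists_nnreal_btwn.mp hpos
  refine ⟨c, by exact_mod_cast hc0, ?_⟩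
  have hlt : -((⨅ x ∈ Δ, I x : ℝ≥0∞) : EReal) < ((-(c : ℝ) : ℝ) : EReal) := by
    rw [EReal.coe_neg, EReal.neg_lt_neg_iff]
    exact EReal.coe_ennreal_lt_coe_ennreal_iff.mpr hc
  filter_upwards [Filter.eventually_lt_of_limsup_lt (lt_of_le_of_lt (h.upper Δ hΔ) hlt),
    Filter.eventually_ne_atTop 0] with N hN hN0
  by_contra hcon
  exact absurd (le_inv_mul_log_of_exp_le hN0 (not_le.mp hcon).le) (not_le.mpr hN)

theorem LargeDeviationPrinciple.iInf_le_of_exp_le (h : LargeDeviationPrinciple μ I) {Δ : Set X}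
    (hΔ : IsClosed Δ) {c : ℝ}
    (hc : ∃ᶠ N : ℕ in Filter.atTop, ENNReal.ofReal (Real.exp (N * -c)) ≤ μ N Δ) :
    ((⨅ x ∈ Δ, I x : ℝ≥0∞) : EReal) ≤ c := by
  have h1 : ((-c : ℝ) : EReal) ≤ -((⨅ x ∈ Δ, I x : ℝ≥0∞) : EReal) := by
    refine le_trans (Filter.le_limsup_of_frequently_le ?_) (h.upper Δ hΔ)
    exact (hc.and_eventually (Filter.eventually_ne_atTop 0)).mono
      fun N hN => le_inv_mul_log_of_exp_le hN.2 hN.1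
  rw [EReal.coe_neg] at h1
  exact EReal.neg_le_neg_iff.mp h1

end LargeDeviations

/-! ### From estimation to testing -/

section Estimation

variable {d : ℕ}

instance State.instRegularSpace (d : ℕ) : RegularSpace (State d) :=
  inferInstanceAs (RegularSpace
    {ρ : Fin d → Fin d → ℂ // Matrix.PosSemidef (Matrix.of ρ) ∧ (Matrix.of ρ).trace = 1})

theorem POVM.apply_compl {X : Type*} [MeasurableSpace X] {ι : Type*} [Fintype ι] [DecidableEq ι]
    (E : POVM X ι) {Δ : Set X} (hΔ : MeasurableSet Δ) :
    E.toVectorMeasure Δᶜ = 1 - E.toVectorMeasure Δ := by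
  rw [← E.univ, ← MeasureTheory.VectorMeasure.of_add_of_sdiff hΔ MeasurableSet.univ
    (Set.subset_univ Δ), add_sub_cancel_left, Set.compl_eq_univ_sdiff]

theorem EstimationScheme.SatisfiesLDP.iInf_le {E : EstimationScheme d (State d)}
    {I : State d → State d → ℝ≥0∞} (hE : E.SatisfiesLDP id I) {ρ σ : State d}
    (hker : ∀ v : Fin d → ℂ, ρ.mat.mulVec v = 0 → σ.mat.mulVec v = 0) {Δ : Set (State d)}
    (hΔ : IsClosed Δ) (hn : Δ ∈ nhds σ) {L : ℝ}
    (hL : (σ.mat * cfc Real.log σ.mat - σ.mat * cfc Real.log ρ.mat).trace.re < L) :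
    ((⨅ x ∈ Δ, I ρ x : ℝ≥0∞) : EReal) ≤ L := by
  -- The gap `L - L'` provides a factor `exp(-N(L - L'))` that absorbs the constant lost in the
  -- Stein bound.
  obtain ⟨L', hL1, hL2⟩ := exists_between hL
  obtain ⟨a, ha0, ha1, ha⟩ := exists_pow_le_trace_of_relativeEntropy_lt hker hL1
  have hΔm : MeasurableSet Δ := hΔ.measurableSet
  have hpos : 0 < ⨅ x ∈ (interior Δ)ᶜ, I σ x :=
    (hE.isRateFunction σ).iInf_pos isOpen_interior.isClosed_compl fun x hx h0 => by
      have hx' : σ = x := (hE.eq_zero_iff σ x).mp h0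
      exact hx (hx' ▸ mem_interior_iff_mem_nhds.mpr hn)
  obtain ⟨c, hc0, hc⟩ := (hE.ldp σ).exists_le_exp isOpen_interior.isClosed_compl hpos
  refine (hE.ldp ρ).iInf_le_of_exp_le hΔ (Filter.Eventually.frequently ?_)
  have hdecay : ∀ b : ℝ, 0 < b →
      Filter.Tendsto (fun N : ℕ => Real.exp (N * -b)) Filter.atTop (nhds 0) := fun b hb =>
    Real.tendsto_exp_atBot.comp
      (tendsto_natCast_atTop_atTop.atTop_mul_const_of_neg (neg_lt_zero.mpr hb))
  -- The thresholds fit because `1/2 * (1 - 1/2) - 1/8 = 1/8`.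
  filter_upwards [hc, (hdecay c hc0).eventually_lt_const (by norm_num : (0 : ℝ) < 1 / 8),
    (hdecay (L - L') (sub_pos.mpr hL2)).eventually_lt_const (by norm_num : (0 : ℝ) < 1 / 8),
    (tendsto_pow_atTop_nhds_zero_of_lt_one ha0 ha1).eventually_lt_const
      (by norm_num : (0 : ℝ) < 1 / 2)] with N h1 h2 h3 h4
  have hcompl := (E N).apply_compl hΔm
  have h5 : (tensorPower N σ.mat * (1 - (E N).toVectorMeasure Δ)).trace.re
      ≤ Real.exp (N * -c) := by
    have h6 := (MeasureTheory.measure_mono (Set.compl_subset_compl.mpr interior_subset)).trans h1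
    rw [E.law_apply N σ hΔm.compl, hcompl] at h6
    exact (ENNReal.ofReal_le_ofReal_iff (Real.exp_pos _).le).mp h6
  have h7 := ha N _ ((E N).posSemidef Δ hΔm) (hcompl ▸ (E N).posSemidef _ hΔm.compl)
  rw [E.law_apply N ρ hΔm]
  refine ENNReal.ofReal_le_ofReal (le_trans ?_ h7)
  have h8 : Real.exp (N * -L) = Real.exp (-(N * L')) * Real.exp (N * -(L - L')) := by
    rw [← Real.exp_add]
    ring_nf
  rw [h8]
  gcongr
  linarith

end Estimation

end StateEstimation

theorem theorem3 (d : ℕ)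
    (I : StateEstimation.State d → StateEstimation.State d → ENNReal)
    (hI : StateEstimation.IsAdmissible (id : StateEstimation.State d → StateEstimation.State d) I)
    (ρ σ : StateEstimation.State d) :
    (I ρ σ : EReal) ≤ StateEstimation.relativeEntropy ρ σ := by
  obtain ⟨E, hE⟩ := hI
  unfold StateEstimation.relativeEntropy
  split_ifs with hker
  · refine StateEstimation.le_of_iInf_closed_nhds_le (hE.isRateFunction ρ).lowerSemicontinuous
      fun Δ hΔ hn => ?_
    refine EReal.le_of_forall_lt_iff_le.mp fun L hL => ?_
    exact hE.iInf_le hker hΔ hn (by exact_mod_cast hL)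
  · exact le_top
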